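/- Let $\mathbb K\in\{\mathbb R,\mathbb C\}$, let $G$ be a (smooth) Banach–Lie group over $\mathbb K$ with Lie algebra $L(G)=T_eG$, let $\Gamma$ be a finitely generated group and let $r:\Gamma\to G$ be a homomorphism. Regard $V=L(G)$ as a $\Gamma$-module via $\gamma.v=\mathrm{Ad}(r(\gamma))v$. Let $1\to R\to F\xrightarrow{\pi}\Gamma\to 1$ be a presentation of $\Gamma$, where $F$ is the free group on a finite set $S$ and $R=\ker\pi$ is free on a subset $T\subseteq R$. Write each $t\in T$ as a reduced word $t=s_{t,1}^{\epsilon_{t,1}}\cdots s_{t,m_t}^{\epsilon_{t,m_t}}$ with $s_{t,j}\in S$ and $\epsilon_{t,j}=\pm1$, and put $\epsilon'_{t,j}=0$ if $\epsilon_{t,j}=1$ and $\epsilon'_{t,j}=-1$ if $\epsilon_{t,j}=-1$. Define $\delta^0:V\to\mathrm{Map}(S,V)$ and $\delta^1:\mathrm{Map}(S,V)\to\mathrm{Map}(T,V)$ by $$\delta^0(v)(s)=v-\pi(s).v,\qquad \delta^1(c)(t)=\sum_{j=1}^{m_t}\epsilon_{t,j}\,\pi\big(s_{t,1}^{\epsilon_{t,1}}\cdots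 s_{t,j-1}^{\epsilon_{t,j-1}}s_{t,j}^{\epsilon'_{t,j}}\big).c(s_{t,j}),$$ and let $H^1(\Gamma,V)=\ker(\delta^1)/\mathrm{im}(\delta^0)$. The space $\mathrm{Map}(T,V)$ carries the topology of pointwise convergence, that is, its Fréchet topology given by the seminorms $f\mapsto\|f(t)\|$, $t\in T$. Suppose that $H^1(\Gamma,L(G))=0$ and that $\delta^1$ has closed image in $\mathrm{Map}(T,L(G))$. Then $r$ is locally rigid: there is an open neighborhood $U$ of $r$ in $\mathrm{Hom}(\Gamma,G)$, with the topology of pointwise convergence, such that for every $r'\in U$ there is $g\in G$ with $r'(\gamma)=g\,r(\gamma)\,g^{-1}$ for all $\gamma\in\Gamma$. -/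

import Mathlib

open scoped Manifold ContDiff Topology

noncomputable section

namespace BanachLie

/-! ### The adjoint action of a Banach-Lie group on its Lie algebra -/

section Adjoint

variable (𝕜 : Type*) [RCLike 𝕜] (E : Type*) [NormedAddCommGroup E] [NormedSpace 𝕜 E]
  {G : Type*} [TopologicalSpace G] [ChartedSpace E G] [Group G]

/-- `Ad(g) : L(G) → L(G)` is the derivative at `1` of the conjugation `x ↦ g * x * g⁻¹`.
(The derivative takes values in the tangent space at `g * 1 * g⁻¹`, that is, at `1`.) -/
def adMap (g : G) : GroupLieAlgebra 𝓘(𝕜, E) G →L[𝕜] GroupLieAlgebra 𝓘(𝕜, E) G :=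
  mfderiv 𝓘(𝕜, E) 𝓘(𝕜, E) (fun x : G => g * x * g⁻¹) 1

theorem adMap_one : adMap 𝕜 E (1 : G) = ContinuousLinearMap.id 𝕜 _ := by
  have h : (fun x : G => 1 * x * 1⁻¹) = id := by ext x; simp
  unfold adMap
  rw [h]
  exact mfderiv_id

variable [LieGroup 𝓘(𝕜, E) ∞ G]

theorem mdifferentiableAt_conj (g x : G) :
    MDifferentiableAt 𝓘(𝕜, E) 𝓘(𝕜, E) (fun x : G => g * x * g⁻¹) x := by
  have h : ContMDiff 𝓘(𝕜, E) 𝓘(𝕜, E) ∞ (fun x : G => g * x * g⁻¹) :=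
    (contMDiff_const.mul contMDiff_id).mul contMDiff_const
  exact h.mdifferentiableAt (by simp)

theorem adMap_mul (g h : G) : adMap 𝕜 E (g * h) = (adMap 𝕜 E g).comp (adMap 𝕜 E h) := by
  have e : (fun x : G => g * h * x * (g * h)⁻¹)
      = (fun x : G => g * x * g⁻¹) ∘ (fun x : G => h * x * h⁻¹) := by
    ext x; simp [mul_assoc]
  have c := mfderiv_comp (I := 𝓘(𝕜, E)) (I' := 𝓘(𝕜, E)) (I'' := 𝓘(𝕜, E)) (1 : G)
    (mdifferentiableAt_conj 𝕜 E g (h * 1 * h⁻¹)) (mdifferentiableAt_conj 𝕜 E h 1)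
  have key : ∀ y : G, y = 1 → ∀ v : E,
      (show E from mfderiv 𝓘(𝕜, E) 𝓘(𝕜, E) (fun x : G => g * x * g⁻¹) y v)
        = (show E from mfderiv 𝓘(𝕜, E) 𝓘(𝕜, E) (fun x : G => g * x * g⁻¹) 1 v) := by
    rintro y rfl v; rfl
  unfold adMap
  rw [e]
  refine ContinuousLinearMap.ext fun v => ?_
  exact (DFunLike.congr_fun c v).trans (key _ (by simp) _)

/-- The adjoint action `Ad : G → Aut(L(G))`, by continuous linear maps. -/
def Ad : G →* (GroupLieAlgebra 𝓘(𝕜, E) G →L[𝕜] GroupLieAlgebra 𝓘(𝕜, E) G) where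
  toFun := adMap 𝕜 E
  map_one' := adMap_one 𝕜 E
  map_mul' := adMap_mul 𝕜 E

/-- The `Γ`-module structure `γ.v = Ad(r(γ))(v)` on `L(G)` defined by a homomorphism
`r : Γ → G`. -/
def adRep {Γ : Type*} [Group Γ] (r : Γ →* G) :
    Representation 𝕜 Γ (GroupLieAlgebra 𝓘(𝕜, E) G) :=
  (ContinuousLinearMap.toLinearMapRingHom :
      (GroupLieAlgebra 𝓘(𝕜, E) G →L[𝕜] GroupLieAlgebra 𝓘(𝕜, E) G) →+* _).toMonoidHom.comp
    ((Ad 𝕜 E).comp r)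

end Adjoint

/-! ### Presentations and the first cohomology group -/

/-- A presentation `1 → R → F → Γ → 1` of the group `Γ`: here `F` is the free group on `S`,
`R` is the kernel of the surjection `π : F → Γ`, and `R` is free on `T`. -/
structure Presentation (Γ : Type*) [Group Γ] (S T : Type*) where
  /-- the projection `F → Γ` -/
  π : FreeGroup S →* Γ
  surjective : Function.Surjective π
  /-- `T` as a basis of the free group `R` -/
  basis : FreeGroupBasis T π.ker

namespace Presentation

variable {Γ : Type*} [Group Γ] {S T : Type*} (P : Presentation Γ S T)

open Classical in
/-- The reduced word in `S` that expresses `t ∈ T ⊆ R ⊆ F`, as the list of the pairs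
`(s_{t,j}, b)` with `b = true` if `ε_{t,j} = 1` and `b = false` if `ε_{t,j} = -1`. -/
def word (t : T) : List (S × Bool) := FreeGroup.toWord (P.basis t : FreeGroup S)

end Presentation

/-- The exponent `ε = ±1` of a letter. -/
def eps (b : Bool) : ℤ := if b then 1 else -1

/-- The exponent `ε'`: it is `0` if `ε = 1`, and `-1` if `ε = -1`. -/
def eps' (b : Bool) : ℤ := if b then 0 else -1

section Cohomology

variable {𝕜 : Type*} [Field 𝕜] {Γ : Type*} [Group Γ] {S T : Type*} (P : Presentation Γ S T)
  {V : Type*} [AddCommGroup V] [Module 𝕜 V] (ρ : Representation 𝕜 Γ V)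

/-- `δ⁰ : V → Map(S, V)`, `δ⁰(v)(s) = v - π(s).v`. -/
def delta0 : V →ₗ[𝕜] (S → V) where
  toFun v s := v - ρ (P.π (FreeGroup.of s)) v
  map_add' v w := by
    ext s
    simp only [map_add, Pi.add_apply]
    abel
  map_smul' a v := by
    ext s
    simp only [map_smul, Pi.smul_apply, RingHom.id_apply, smul_sub]

/-- `δ¹ : Map(S, V) → Map(T, V)`,
`δ¹(c)(t) = ∑_j ε_{t,j} π(s_{t,1}^{ε_{t,1}} ⋯ s_{t,j-1}^{ε_{t,j-1}} s_{t,j}^{ε'_{t,j}}).c(s_{t,j})`,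
where `s_{t,1}^{ε_{t,1}} ⋯ s_{t,m}^{ε_{t,m}}` is the reduced word of `t`. -/
def delta1 : (S → V) →ₗ[𝕜] (T → V) where
  toFun c t := ∑ j : Fin (P.word t).length,
    eps ((P.word t).get j).2 •
      ρ (P.π (FreeGroup.mk ((P.word t).take j)
          * FreeGroup.of ((P.word t).get j).1 ^ eps' ((P.word t).get j).2))
        (c ((P.word t).get j).1)
  map_add' c d := by
    ext t
    simp only [Pi.add_apply, map_add, smul_add, Finset.sum_add_distrib]
  map_smul' a c := by
    ext t
    simp only [Pi.smul_apply, map_smul, RingHom.id_apply, Finset.smul_sum]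
    exact Finset.sum_congr rfl fun j _ => smul_comm _ _ _

/-- `H¹(Γ, V) = ker δ¹ / im δ⁰`. -/
abbrev H1 : Type _ :=
  LinearMap.ker (delta1 P ρ) ⧸
    (LinearMap.range (delta0 P ρ)).submoduleOf (LinearMap.ker (delta1 P ρ))

end Cohomology

/-! ### Local rigidity -/

/-- The topology of pointwise convergence on `Hom(Γ, G)`. -/
abbrev homTopology (Γ G : Type*) [Group Γ] [Group G] [TopologicalSpace G] :
    TopologicalSpace (Γ →* G) :=
  TopologicalSpace.induced (fun f : Γ →* G => (f : Γ → G)) inferInstance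

/-- `r` is locally rigid: it has an open neighborhood in `Hom(Γ, G)` all of whose elements are
conjugate to `r`. -/
def LocallyRigid {Γ G : Type*} [Group Γ] [Group G] [TopologicalSpace G] (r : Γ →* G) : Prop :=
  ∃ U : Set (Γ →* G), IsOpen[homTopology Γ G] U ∧ r ∈ U ∧
    ∀ r' ∈ U, ∃ g : G, ∀ γ : Γ, r' γ = g * r γ * g⁻¹

end BanachLie

end

/-!
The theorem is an implicit function argument in which no complement is available, so that the
conjugating element is produced by a Newton iteration.

Write `q = r ∘ π`. A homomorphism `q'` of the free group that is close to `q` has the form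
`q' s = ψ (c s) * q s`, where `ψ` is the inverse of a chart of `G` centered at `1` and
`c : S → L(G)` is small (`exists_nhds_eq_perturb`). It factors through `Γ` if and only if the word
maps `c ↦ q' t`, `t ∈ T`, take the value `1`. Their derivative at `c = 0` is `δ¹`
(`hasUnitDeriv_word`, `wordDeriv_apply`), and conjugation by `ψ (-v)` changes `c` into
`c - δ⁰ v` up to first order (`hasUnitDeriv_conj_perturb`).

Since `δ¹` has closed image and `T` is countable, the Baire category theorem gives an open mapping
theorem for `δ¹`: finitely many relations control the distance of `c` from `ker δ¹`. As
`ker δ¹ ⊆ im δ⁰`, an approximate cocycle is close to a coboundary `δ⁰ v` with `v` of controlled norm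
(`exists_finset_almost_exact`). It is the finiteness of the set of relations that makes the
linearization errors uniformly small. A small `c` coming from a homomorphism of `Γ` satisfies
`δ¹ c = o(c)` at these relations, so that conjugation by `ψ (-v)`, for a suitable `v = O(c)`, at
least halves its norm (`exists_conj_perturb_norm_le_half`). The products of the conjugating elements
form a Cauchy sequence in the chart, and their limit conjugates `q'` to `q`
(`exists_conj_of_perturb`).
-/

/-! ### Quantitative exactness of complexes of Banach spaces -/

section Linear

variable {𝕜 : Type*} [RCLike 𝕜] {X Y F T : Type*}
  [NormedAddCommGroup X] [NormedSpace 𝕜 X] [NormedAddCommGroup Y] [NormedSpace 𝕜 Y]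
  [NormedAddCommGroup F] [NormedSpace 𝕜 F] [CompleteSpace F] [Countable T]

/-- The Baire category half of the open mapping theorem: a map with closed image in a countable
power of a Banach space is almost open onto its image. A neighborhood of `0` in the product
constrains only finitely many coordinates, hence the finite set `T₀`. -/
theorem exists_finset_mem_closure_image_closedBall
    (d : Y →L[𝕜] (T → F)) (hd : IsClosed (Set.range d)) :
    ∃ (T₀ : Finset T) (K : ℝ), 0 < K ∧ ∀ (δ : ℝ), 0 < δ → ∀ y : Y,
      (∀ t ∈ T₀, ‖d y t‖ < δ) → d y ∈ closure (d '' Metric.closedBall 0 (K * δ)) := by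
  have : CompleteSpace (Set.range d) := hd.completeSpace_coe
  let f : ℕ → Set (Set.range d) := fun n =>
    Subtype.val ⁻¹' closure (d '' Metric.closedBall 0 (n : ℝ))
  have hf : ∀ n, IsClosed (f n) := fun n => isClosed_closure.preimage continuous_subtype_val
  have hU : ⋃ n, f n = Set.univ := by
    refine Set.eq_univ_of_forall fun ⟨z, y, hy⟩ => Set.mem_iUnion.2 ?_
    obtain ⟨n, hn⟩ := exists_nat_ge ‖y‖
    exact ⟨n, subset_closure ⟨y, by simpa using hn, hy⟩⟩
  have : Nonempty (Set.range d) := ⟨⟨d 0, 0, rfl⟩⟩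
  obtain ⟨n, ⟨z, y₀, rfl⟩, hz⟩ := nonempty_interior_of_iUnion_of_closed hf hU
  obtain ⟨V, hV, hVf⟩ := mem_nhds_subtype _ _ _ |>.1 (mem_interior_iff_mem_nhds.1 hz)
  rw [nhds_pi, Filter.mem_pi'] at hV
  obtain ⟨T₀, W, hW, hWV⟩ := hV
  choose ε hε hεW using fun t => Metric.mem_nhds_iff.1 (hW t)
  obtain ⟨ε₀, hε₀, hle⟩ : ∃ ε₀ > 0, ∀ t ∈ T₀, ε₀ ≤ ε t := by
    rcases T₀.eq_empty_or_nonempty with rfl | hne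
    · exact ⟨1, one_pos, by simp⟩
    · exact ⟨T₀.inf' hne ε, (Finset.lt_inf'_iff hne).2 fun t _ => hε t,
        fun t ht => Finset.inf'_le _ ht⟩
  have key : ∀ y : Y, (∀ t ∈ T₀, ‖d y t‖ < ε₀) →
      d y ∈ closure (d '' Metric.closedBall 0 (2 * n + 1 : ℝ)) := by
    intro y hy
    have h1 : d (y₀ + y) ∈ closure (d '' Metric.closedBall 0 (n : ℝ)) := by
      refine @hVf ⟨d (y₀ + y), y₀ + y, rfl⟩ (hWV fun t ht => hεW t ?_)
      simpa using (hy t ht).trans_le (hle t ht)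
    have h0 : d y₀ ∈ closure (d '' Metric.closedBall 0 (n : ℝ)) := 
      (interior_subset hz : (⟨d y₀, y₀, rfl⟩ : Set.range d) ∈ f n)
    have := map_mem_closure₂ continuous_sub h1 h0
      (u := d '' Metric.closedBall 0 (2 * n + 1 : ℝ)) (by
      rintro _ ⟨a, ha, rfl⟩ _ ⟨b, hb, rfl⟩
      refine ⟨a - b, ?_, by simp⟩
      rw [mem_closedBall_zero_iff] at *
      linarith [norm_sub_le a b])
    simpa using this
  refine ⟨T₀, (2 * n + 1) / ε₀, by positivity, fun δ hδ y hy => ?_⟩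
  have hs : ∀ a : ℝ, 0 < a → ‖(a : 𝕜)‖ = a := fun a ha => by simp [abs_of_pos ha]
  have h1 := key (((ε₀ / δ : ℝ) : 𝕜) • y) fun t ht => by
    rw [map_smul, Pi.smul_apply, norm_smul, hs _ (by positivity), div_mul_eq_mul_div,
      div_lt_iff₀ hδ]
    exact mul_lt_mul_of_pos_left (hy t ht) hε₀
  have h2 := map_mem_closure (continuous_const_smul ((δ / ε₀ : ℝ) : 𝕜)) h1
    (t := d '' Metric.closedBall 0 ((2 * n + 1) / ε₀ * δ)) (by
      rintro _ ⟨a, ha, rfl⟩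
      refine ⟨((δ / ε₀ : ℝ) : 𝕜) • a, ?_, by simp only [map_smul]⟩
      rw [mem_closedBall_zero_iff] at *
      rw [norm_smul, hs _ (by positivity)]
      calc δ / ε₀ * ‖a‖ ≤ δ / ε₀ * (2 * n + 1) := by gcongr
        _ = _ := by ring)
  have h3 : ((δ / ε₀ : ℝ) : 𝕜) * ((ε₀ / δ : ℝ) : 𝕜) = 1 := by
    rw [← RCLike.ofReal_mul]
    field_simp
    simp
  rwa [map_smul, smul_smul, h3, one_smul] at h2

/-- An open mapping theorem: if a map from a Banach space to a countable power of a Banach space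
has closed image, then finitely many coordinates of `d y` control a preimage of `d y`. -/
theorem exists_finset_preimage_norm_le [CompleteSpace Y]
    (d : Y →L[𝕜] (T → F)) (hd : IsClosed (Set.range d)) :
    ∃ (T₀ : Finset T) (K : ℝ), 0 < K ∧ ∀ (δ : ℝ), 0 < δ → ∀ y : Y,
      (∀ t ∈ T₀, ‖d y t‖ < δ) → ∃ u, ‖u‖ ≤ K * δ ∧ d u = d y := by
  obtain ⟨T₀, K, hK, h⟩ := exists_finset_mem_closure_image_closedBall d hd
  refine ⟨T₀, 2 * K, by positivity, fun δ hδ y hy => ?_⟩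
  have step : ∀ (δ : ℝ), 0 < δ → ∀ y : Y, (∀ t ∈ T₀, ‖d y t‖ < δ) →
      ∃ u, ‖u‖ ≤ K * δ ∧ ∀ t ∈ T₀, ‖d (y - u) t‖ < δ / 2 := by
    intro δ hδ y hy
    have hO : {z : T → F | ∀ t ∈ T₀, ‖d y t - z t‖ < δ / 2} ∈ 𝓝 (d y) := by
      have : ∀ t ∈ T₀, ∀ᶠ z : T → F in 𝓝 (d y), ‖d y t - z t‖ < δ / 2 := fun t _ => by
        have hc : Continuous fun z : T → F => ‖d y t - z t‖ := by fun_prop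
        exact hc.continuousAt.eventually_lt continuousAt_const (by simpa using hδ)
      exact (Filter.eventually_all_finset T₀).2 this
    obtain ⟨_, hz, u, hu, rfl⟩ := mem_closure_iff_nhds.1 (h δ hδ y hy) _ hO
    exact ⟨u, by simpa using hu, fun t ht => by simpa using hz t ht⟩
  choose! U hU hU' using step
  let s : ℕ → Y := fun n => Nat.rec y (fun n z => z - U (δ / 2 ^ n) z) n
  have hs : ∀ n, s (n + 1) = s n - U (δ / 2 ^ n) (s n) := fun n => rfl
  have hsd : ∀ n, ∀ t ∈ T₀, ‖d (s n) t‖ < δ / 2 ^ n := by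
    intro n
    induction n with
    | zero => simpa [s] using hy
    | succ n ih =>
      intro t ht
      rw [hs, pow_succ, ← div_div]
      exact hU' _ (by positivity) _ ih t ht
  have hdist : ∀ n, dist (y - s n) (y - s (n + 1)) ≤ (2 * K * δ) / 2 / 2 ^ n := by
    intro n
    rw [hs, dist_eq_norm]
    have := hU (δ / 2 ^ n) (by positivity) (s n) (hsd n)
    calc _ = ‖U (δ / 2 ^ n) (s n)‖ := by rw [← norm_neg]; congr 1; abel
      _ ≤ _ := this
      _ = _ := by ring
  obtain ⟨u, hu⟩ := cauchySeq_tendsto_of_complete (cauchySeq_of_le_geometric_two hdist)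
  refine ⟨u, ?_, ?_⟩
  · have := dist_le_of_le_geometric_two_of_tendsto₀ hdist hu
    simpa [s, dist_eq_norm] using this
  · have hgeo : Filter.Tendsto (fun n : ℕ => K * (δ / 2 ^ n)) Filter.atTop (𝓝 0) := by
      have := (tendsto_pow_atTop_nhds_zero_of_lt_one (r := (1 / 2 : ℝ)) (by norm_num)
        (by norm_num)).const_mul (K * δ)
      simpa [div_eq_mul_inv, mul_assoc] using this
    have h0 : Filter.Tendsto (fun n => d (s n)) Filter.atTop (𝓝 0) := by
      rw [tendsto_pi_nhds]
      intro t
      let p : Y →L[𝕜] F := (ContinuousLinearMap.proj t).comp d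
      have hb : ∀ n, ‖d (s n) t‖ ≤ ‖p‖ * (K * (δ / 2 ^ n)) := by
        intro n
        have hcl : IsClosed {z : T → F | ‖z t‖ ≤ ‖p‖ * (K * (δ / 2 ^ n))} :=
          isClosed_le (by fun_prop) continuous_const
        refine closure_minimal ?_ hcl (h (δ / 2 ^ n) (by positivity) (s n) (hsd n))
        rintro _ ⟨a, ha, rfl⟩
        exact (p.le_opNorm a).trans (by gcongr; simpa using ha)
      exact squeeze_zero_norm hb (by simpa using hgeo.const_mul ‖p‖)
    have h1 := (d.continuous.tendsto u).comp hu
    have h2 := (tendsto_const_nhds (x := d y)).sub h0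
    refine tendsto_nhds_unique h1 ?_
    simpa [Function.comp_def] using h2

/-- Stability of exactness: for a complex `X → Y → F ^ T` that is exact at `Y` and whose second
map has closed image, an element `c` of `Y` that is almost a cocycle, in finitely many
coordinates, is almost a coboundary, of an element whose norm is controlled. -/
theorem exists_finset_almost_exact [CompleteSpace X] [CompleteSpace Y]
    (d₀ : X →L[𝕜] Y) (d : Y →L[𝕜] (T → F)) (hd : IsClosed (Set.range d))
    (hexact : ∀ y, d y = 0 → ∃ x, d₀ x = y) :
    ∃ (T₀ : Finset T) (C : ℝ), 0 < C ∧ ∀ (δ : ℝ), 0 < δ → ∀ c : Y,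
      (∀ t ∈ T₀, ‖d c t‖ < δ) → ∃ v, ‖v‖ ≤ C * (‖c‖ + δ) ∧ ‖c - d₀ v‖ ≤ C * δ := by
  obtain ⟨T₀, K, hK, h⟩ := exists_finset_preimage_norm_le d hd
  let Z : Submodule 𝕜 Y := LinearMap.ker (d : Y →ₗ[𝕜] (T → F))
  have hZ : IsClosed (Z : Set Y) := d.isClosed_ker
  let X' : Submodule 𝕜 X := Z.comap (d₀ : X →ₗ[𝕜] Y)
  have hX' : IsClosed (X' : Set X) := hZ.preimage d₀.continuous
  have : CompleteSpace Z := hZ.completeSpace_coe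
  have : CompleteSpace X' := hX'.completeSpace_coe
  let f : X' →L[𝕜] Z := (d₀.comp X'.subtypeL).codRestrict Z fun x => x.2
  have hf : Function.Surjective f := by
    rintro ⟨y, hy⟩
    obtain ⟨x, rfl⟩ := hexact y hy
    exact ⟨⟨x, hy⟩, rfl⟩
  obtain ⟨C, hC, hCf⟩ := f.exists_preimage_norm_le hf
  refine ⟨T₀, max K (C * (1 + K)), lt_max_of_lt_left hK, fun δ hδ c hc => ?_⟩
  obtain ⟨u, hu, hud⟩ := h δ hδ c hc
  have hmem : c - u ∈ Z := by
    change d (c - u) = 0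
    rw [map_sub, hud, sub_self]
  obtain ⟨x, hx, hxn⟩ := hCf ⟨c - u, hmem⟩
  have hx' : d₀ x = c - u := congrArg Subtype.val hx
  refine ⟨x, ?_, ?_⟩
  · calc ‖(x : X)‖ ≤ C * ‖c - u‖ := hxn
      _ ≤ C * (‖c‖ + K * δ) := by gcongr; exact (norm_sub_le _ _).trans (by gcongr)
      _ ≤ C * (1 + K) * (‖c‖ + δ) := by
        rw [mul_assoc]
        gcongr
        nlinarith [norm_nonneg c]
      _ ≤ _ := by gcongr; exact le_max_right _ _
  · rw [hx', sub_sub_cancel]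
    exact hu.trans (by gcongr; exact le_max_left _ _)

end Linear

noncomputable section

namespace BanachLie

/-! ### A centered chart at the identity -/

section Germ

variable (𝕜 : Type*) [RCLike 𝕜] (E : Type*) [NormedAddCommGroup E] [NormedSpace 𝕜 E]
  {G : Type*} [TopologicalSpace G] [ChartedSpace E G] [Group G]

/-- The preferred chart of `G` at `1`, translated so that `1` is sent to `0`. Outside the domain
of the chart the values are irrelevant. -/
def unitChart (g : G) : E := extChartAt 𝓘(𝕜, E) (1 : G) g - extChartAt 𝓘(𝕜, E) (1 : G) 1

variable (G) in
/-- The local inverse of `unitChart`, sending `0` to `1`. -/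
def unitParam (v : E) : G :=
  (extChartAt 𝓘(𝕜, E) (1 : G)).symm (v + extChartAt 𝓘(𝕜, E) (1 : G) 1)

theorem unitChart_one : unitChart 𝕜 E (1 : G) = 0 := sub_self _

theorem unitParam_zero : unitParam 𝕜 E G 0 = 1 := by
  simp [unitParam]

theorem eventually_unitParam_unitChart :
    ∀ᶠ g in 𝓝 (1 : G), unitParam 𝕜 E G (unitChart 𝕜 E g) = g := by
  filter_upwards [extChartAt_source_mem_nhds (I := 𝓘(𝕜, E)) (1 : G)] with g hg
  rw [unitParam, unitChart, sub_add_cancel]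
  exact (extChartAt 𝓘(𝕜, E) (1 : G)).left_inv hg

theorem tendsto_add_extChartAt_one : Filter.Tendsto
    (fun v : E => v + extChartAt 𝓘(𝕜, E) (1 : G) 1) (𝓝 0) (𝓝 (extChartAt 𝓘(𝕜, E) (1 : G) 1)) := by
  have : Continuous (fun v : E => v + extChartAt 𝓘(𝕜, E) (1 : G) 1) := by fun_prop
  simpa using this.tendsto 0

theorem eventually_add_mem_target : ∀ᶠ v in 𝓝 (0 : E),
    v + extChartAt 𝓘(𝕜, E) (1 : G) 1 ∈ (extChartAt 𝓘(𝕜, E) (1 : G)).target :=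
  (tendsto_add_extChartAt_one 𝕜 E).eventually (extChartAt_target_mem_nhds (1 : G))

theorem eventually_unitChart_unitParam :
    ∀ᶠ v in 𝓝 (0 : E), unitChart 𝕜 E (unitParam 𝕜 E G v) = v := by
  filter_upwards [eventually_add_mem_target (G := G) 𝕜 E] with v hv
  rw [unitParam, unitChart, (extChartAt 𝓘(𝕜, E) (1 : G)).right_inv hv, add_sub_cancel_right]

theorem eventually_continuousAt_unitParam :
    ∀ᶠ v in 𝓝 (0 : E), ContinuousAt (unitParam 𝕜 E G) v := by
  filter_upwards [eventually_add_mem_target (G := G) 𝕜 E] with v hv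
  exact ContinuousAt.comp (continuousAt_extChartAt_symm'' hv) (by fun_prop)

theorem contMDiffAt_unitChart :
    ContMDiffAt 𝓘(𝕜, E) 𝓘(𝕜, E) ∞ (unitChart 𝕜 E : G → E) 1 :=
  contMDiffAt_extChartAt.sub contMDiffAt_const

/-! ### First order calculus of maps into a Lie group at the identity -/

variable {E} {M : Type*} [NormedAddCommGroup M] [NormedSpace 𝕜 M]

/-- The map `a : M → G` on a normed space is smooth at `0`, takes the value `1` there, and has the
derivative `a' : M → L(G)`, where `L(G)` is identified with the model space `E` by the chart. -/
structure HasUnitDeriv (a : M → G) (a' : M →L[𝕜] E) : Prop where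
  smooth : ContMDiffAt 𝓘(𝕜, M) 𝓘(𝕜, E) ∞ a 0
  map_zero : a 0 = 1
  hasFDerivAt : HasFDerivAt (fun x => unitChart 𝕜 E (a x)) a' 0

variable {𝕜}

theorem contDiffAt_unitChart_comp {a : M → G} (ha : ContMDiffAt 𝓘(𝕜, M) 𝓘(𝕜, E) ∞ a 0)
    (h0 : a 0 = 1) : ContDiffAt 𝕜 ∞ (fun x => unitChart 𝕜 E (a x)) 0 := by
  rw [← contMDiffAt_iff_contDiffAt]
  have h : ContMDiffAt 𝓘(𝕜, E) 𝓘(𝕜, E) ∞ (unitChart 𝕜 E : G → E) (a 0) := by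
    rw [h0]; exact contMDiffAt_unitChart 𝕜 E
  exact h.comp (0 : M) ha

theorem hasUnitDeriv_fderiv {a : M → G} (ha : ContMDiffAt 𝓘(𝕜, M) 𝓘(𝕜, E) ∞ a 0)
    (h0 : a 0 = 1) : HasUnitDeriv 𝕜 a (fderiv 𝕜 (fun x => unitChart 𝕜 E (a x)) 0) :=
  ⟨ha, h0, ((contDiffAt_unitChart_comp ha h0).differentiableAt (by simp)).hasFDerivAt⟩

namespace HasUnitDeriv

variable {a b : M → G} {a' b' : M →L[𝕜] E}

theorem tendsto (ha : HasUnitDeriv 𝕜 a a') : Filter.Tendsto a (𝓝 0) (𝓝 1) := by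
  simpa [ha.map_zero] using ha.smooth.continuousAt.tendsto

theorem congr_deriv (ha : HasUnitDeriv 𝕜 a a') (h : a' = b') : HasUnitDeriv 𝕜 a b' := h ▸ ha

theorem congr_fun (ha : HasUnitDeriv 𝕜 a a') (h : ∀ x, b x = a x) : HasUnitDeriv 𝕜 b a' :=
  (funext h : b = a) ▸ ha

theorem one : HasUnitDeriv 𝕜 (fun _ : M => (1 : G)) (0 : M →L[𝕜] E) :=
  ⟨contMDiffAt_const, rfl, hasFDerivAt_const _ _⟩

theorem eventually_unitParam (ha : HasUnitDeriv 𝕜 a a') :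
    ∀ᶠ x in 𝓝 0, unitParam 𝕜 E G (unitChart 𝕜 E (a x)) = a x :=
  ha.tendsto.eventually (eventually_unitParam_unitChart 𝕜 E)

theorem hasStrictFDerivAt (ha : HasUnitDeriv 𝕜 a a') :
    HasStrictFDerivAt (fun x => unitChart 𝕜 E (a x)) a' 0 :=
  (contDiffAt_unitChart_comp ha.smooth ha.map_zero).hasStrictFDerivAt' ha.hasFDerivAt (by simp)

theorem eventually_norm_sub_le (ha : HasUnitDeriv 𝕜 a a') {η : ℝ} (hη : 0 < η) :
    ∀ᶠ x in 𝓝 0, ‖unitChart 𝕜 E (a x) - a' x‖ ≤ η * ‖x‖ := by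
  have h := ha.hasFDerivAt.isLittleO.def hη
  filter_upwards [h] with x hx
  simpa [ha.map_zero, unitChart_one] using hx

end HasUnitDeriv

variable (𝕜 E) in
/-- The adjoint action `Ad(g)`, as an operator on the model space `E` of `G`, to which `L(G)`
reduces by definition. -/
def adModel (g : G) : E →L[𝕜] E := adMap 𝕜 E g

variable (𝕜 E) in
theorem adModel_one : adModel 𝕜 E (1 : G) = ContinuousLinearMap.id 𝕜 E := adMap_one 𝕜 E

variable [LieGroup 𝓘(𝕜, E) ∞ G]

variable (𝕜 E) in
theorem contMDiffAt_unitParam : ContMDiffAt 𝓘(𝕜, E) 𝓘(𝕜, E) ∞ (unitParam 𝕜 E G) 0 := by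
  have h1 : ContMDiffAt 𝓘(𝕜, E) 𝓘(𝕜, E) ∞ (extChartAt 𝓘(𝕜, E) (1 : G)).symm
      (0 + extChartAt 𝓘(𝕜, E) (1 : G) 1) := by
    rw [zero_add]
    exact (contMDiffOn_extChartAt_symm (1 : G)).contMDiffAt (extChartAt_target_mem_nhds (1 : G))
  have h2 : ContMDiffAt 𝓘(𝕜, E) 𝓘(𝕜, E) ∞
      (fun v : E => v + extChartAt 𝓘(𝕜, E) (1 : G) 1) 0 :=
    (contDiff_id.add contDiff_const).contMDiff.contMDiffAt
  exact h1.comp (0 : E) h2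

namespace HasUnitDeriv

variable {a b : M → G} {a' b' : M →L[𝕜] E}

variable (G) in
theorem param (l : M →L[𝕜] E) : HasUnitDeriv 𝕜 (fun x => unitParam 𝕜 E G (l x)) l where
  smooth := by
    have h : ContMDiffAt 𝓘(𝕜, E) 𝓘(𝕜, E) ∞ (unitParam 𝕜 E G) (l 0) := by
      rw [_root_.map_zero]; exact contMDiffAt_unitParam 𝕜 E
    exact h.comp (0 : M) l.contDiff.contMDiff.contMDiffAt
  map_zero := by simp only [ContinuousLinearMap.map_zero, unitParam_zero]
  hasFDerivAt := by
    have h : Filter.Tendsto l (𝓝 0) (𝓝 0) := by simpa using l.continuous.tendsto 0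
    refine l.hasFDerivAt.congr_of_eventuallyEq ?_
    exact h.eventually (eventually_unitChart_unitParam 𝕜 E)

/-- The product in the chart at `1` has the derivative `(v, w) ↦ v + w` at the origin. -/
theorem param_mul_param : HasUnitDeriv 𝕜
    (fun p : E × E => unitParam 𝕜 E G p.1 * unitParam 𝕜 E G p.2)
    (ContinuousLinearMap.fst 𝕜 E E + ContinuousLinearMap.snd 𝕜 E E) := by
  have hf := param G (ContinuousLinearMap.fst 𝕜 E E)
  have hs := param G (ContinuousLinearMap.snd 𝕜 E E)
  have h := hasUnitDeriv_fderiv (hf.smooth.mul hs.smooth)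
    (by simp [unitParam_zero])
  refine h.congr_deriv ?_
  set D := fderiv 𝕜 (fun x => unitChart 𝕜 E
    (((fun p : E × E => unitParam 𝕜 E G (ContinuousLinearMap.fst 𝕜 E E p)) *
      fun p => unitParam 𝕜 E G (ContinuousLinearMap.snd 𝕜 E E p)) x)) 0
  have hD := h.hasFDerivAt
  have hi : D.comp (ContinuousLinearMap.inl 𝕜 E E) = ContinuousLinearMap.id 𝕜 E := by
    refine HasFDerivAt.unique (HasFDerivAt.comp (0 : E) (by rwa [ContinuousLinearMap.map_zero])
      (ContinuousLinearMap.inl 𝕜 E E).hasFDerivAt) ?_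
    refine (hasFDerivAt_id (0 : E)).congr_of_eventuallyEq ?_
    filter_upwards [eventually_unitChart_unitParam (G := G) 𝕜 E] with v hv
    simp [unitParam_zero, hv]
  have hr : D.comp (ContinuousLinearMap.inr 𝕜 E E) = ContinuousLinearMap.id 𝕜 E := by
    refine HasFDerivAt.unique (HasFDerivAt.comp (0 : E) (by rwa [ContinuousLinearMap.map_zero])
      (ContinuousLinearMap.inr 𝕜 E E).hasFDerivAt) ?_
    refine (hasFDerivAt_id (0 : E)).congr_of_eventuallyEq ?_
    filter_upwards [eventually_unitChart_unitParam (G := G) 𝕜 E] with v hv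
    simp [unitParam_zero, hv]
  refine ContinuousLinearMap.ext fun ⟨v, w⟩ => ?_
  have h1 : D (v, 0) = v := DFunLike.congr_fun hi v
  have h2 : D (0, w) = w := DFunLike.congr_fun hr w
  calc D (v, w) = D ((v, 0) + (0, w)) := by simp
    _ = v + w := by rw [map_add, h1, h2]

theorem mul (ha : HasUnitDeriv 𝕜 a a') (hb : HasUnitDeriv 𝕜 b b') :
    HasUnitDeriv 𝕜 (fun x => a x * b x) (a' + b') where
  smooth := ha.smooth.mul hb.smooth
  map_zero := by rw [ha.map_zero, hb.map_zero, one_mul]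
  hasFDerivAt := by
    have hm : HasFDerivAt (fun p : E × E => unitChart 𝕜 E
        (unitParam 𝕜 E G p.1 * unitParam 𝕜 E G p.2))
        (ContinuousLinearMap.fst 𝕜 E E + ContinuousLinearMap.snd 𝕜 E E)
        (unitChart 𝕜 E (a 0), unitChart 𝕜 E (b 0)) := by
      rw [ha.map_zero, hb.map_zero, unitChart_one]
      exact param_mul_param.hasFDerivAt
    refine (hm.comp (0 : M) (ha.hasFDerivAt.prodMk hb.hasFDerivAt)).congr_of_eventuallyEq ?_
    filter_upwards [ha.eventually_unitParam, hb.eventually_unitParam] with x h1 h2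
    simp only [Function.comp_apply, h1, h2]

theorem inv (ha : HasUnitDeriv 𝕜 a a') : HasUnitDeriv 𝕜 (fun x => (a x)⁻¹) (-a') := by
  have h := hasUnitDeriv_fderiv ha.smooth.inv (by simp [ha.map_zero])
  refine h.congr_deriv (eq_neg_of_add_eq_zero_right ?_)
  exact ((ha.mul h).congr_fun (b := fun _ => 1) fun x => by simp).hasFDerivAt.unique
    one.hasFDerivAt

end HasUnitDeriv

theorem hasFDerivAt_conj (g : G) :
    HasFDerivAt (fun v => unitChart 𝕜 E (g * unitParam 𝕜 E G v * g⁻¹)) (adModel 𝕜 E g) 0 := by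
  have h : HasFDerivWithinAt (writtenInExtChartAt 𝓘(𝕜, E) 𝓘(𝕜, E) (1 : G)
      (fun x : G => g * x * g⁻¹)) (adModel 𝕜 E g) (Set.range 𝓘(𝕜, E))
      (extChartAt 𝓘(𝕜, E) (1 : G) 1) :=
    (mdifferentiableAt_conj 𝕜 E g (1 : G)).hasMFDerivAt.2
  rw [ModelWithCorners.range_eq_univ, hasFDerivWithinAt_univ] at h
  have h1 : HasFDerivAt (writtenInExtChartAt 𝓘(𝕜, E) 𝓘(𝕜, E) (1 : G)
      (fun x : G => g * x * g⁻¹)) (adModel 𝕜 E g)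
      (0 + extChartAt 𝓘(𝕜, E) (1 : G) 1) := by
    rw [zero_add]; exact h
  have h2 : HasFDerivAt (fun v : E => v + extChartAt 𝓘(𝕜, E) (1 : G) 1)
      (ContinuousLinearMap.id 𝕜 E) 0 := (hasFDerivAt_id _).add_const _
  refine ((h1.comp (0 : E) h2).sub_const (extChartAt 𝓘(𝕜, E) (1 : G) 1)).congr_of_eventuallyEq ?_
  refine Filter.Eventually.of_forall fun v => ?_
  have he : g * 1 * g⁻¹ = 1 := by simp
  simp only [unitChart, unitParam, Function.comp_apply, writtenInExtChartAt, he]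

theorem HasUnitDeriv.conj {a : M → G} {a' : M →L[𝕜] E} (ha : HasUnitDeriv 𝕜 a a') (g : G) :
    HasUnitDeriv 𝕜 (fun x => g * a x * g⁻¹) ((adModel 𝕜 E g).comp a') where
  smooth := (contMDiffAt_const.mul ha.smooth).mul contMDiffAt_const
  map_zero := by simp [ha.map_zero]
  hasFDerivAt := by
    have hm : HasFDerivAt (fun v => unitChart 𝕜 E (g * unitParam 𝕜 E G v * g⁻¹))
        (adModel 𝕜 E g) (unitChart 𝕜 E (a 0)) := by
      rw [ha.map_zero, unitChart_one]
      exact hasFDerivAt_conj g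
    refine (hm.comp (0 : M) ha.hasFDerivAt).congr_of_eventuallyEq ?_
    filter_upwards [ha.eventually_unitParam] with x h1
    simp only [Function.comp_apply, h1]

end Germ

end BanachLie
end

noncomputable section

namespace BanachLie

section Words

variable (𝕜 : Type*) [RCLike 𝕜] (E : Type*) [NormedAddCommGroup E] [NormedSpace 𝕜 E]
  {G : Type*} [TopologicalSpace G] [ChartedSpace E G] [Group G]
  {S : Type*}

/-! ### Perturbations of a homomorphism on a free group -/

/-- The homomorphism with the value `unitParam (c s) * q s` at the generator `s`. Every
homomorphism near `q` is of this form. -/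
def perturb (q : FreeGroup S →* G) (c : S → E) : FreeGroup S →* G :=
  FreeGroup.lift fun s => unitParam 𝕜 E G (c s) * q (FreeGroup.of s)

variable {𝕜 E} in
/-- Homomorphisms that are close to `q` at the generators have the form `perturb q c` with `c`
small. -/
theorem exists_nhds_eq_perturb [Fintype S] (q : FreeGroup S →* G) {ρ : ℝ} (hρ : 0 < ρ) :
    ∃ N : Set G, IsOpen N ∧ 1 ∈ N ∧ ∀ q' : FreeGroup S →* G,
      (∀ s, q' (FreeGroup.of s) * (q (FreeGroup.of s))⁻¹ ∈ N) →
      ∃ c : S → E, ‖c‖ < ρ ∧ q' = perturb 𝕜 E q c := by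
  have hc : Filter.Tendsto (unitChart 𝕜 E : G → E) (𝓝 1) (𝓝 0) := by
    have := (contMDiffAt_unitChart (G := G) 𝕜 E).continuousAt.tendsto
    rwa [unitChart_one] at this
  obtain ⟨N, hN, hNo, hN1⟩ := eventually_nhds_iff.1
    ((eventually_unitParam_unitChart (G := G) 𝕜 E).and
      (hc.eventually (Metric.ball_mem_nhds (0 : E) hρ)))
  refine ⟨N, hNo, hN1, fun q' hq' =>
    ⟨fun s => unitChart 𝕜 E (q' (FreeGroup.of s) * (q (FreeGroup.of s))⁻¹), ?_, ?_⟩⟩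
  · refine (pi_norm_lt_iff hρ).2 fun s => ?_
    simpa using (hN _ (hq' s)).2
  · refine FreeGroup.ext_hom _ _ fun s => ?_
    rw [perturb, FreeGroup.lift_apply_of, (hN _ (hq' s)).1, inv_mul_cancel_right]

/-! ### The derivative of the word maps -/

/-- The derivative at `c = 0` of the value of a letter under the perturbation
`s ↦ unitParam (c s) * q s` of `q`, translated back to `1` from the right. -/
def letterDeriv (q : FreeGroup S →* G) (x : S × Bool) : (S → E) →L[𝕜] E :=
  if x.2 then ContinuousLinearMap.proj x.1
  else -(adModel 𝕜 E (q (FreeGroup.of x.1))⁻¹).comp (ContinuousLinearMap.proj x.1)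

/-- The derivative at `c = 0` of the value of a word under the perturbation
`s ↦ unitParam (c s) * q s` of `q`, translated back to `1` from the right. The recursion is the
cocycle identity of Fox calculus. -/
def wordDeriv (q : FreeGroup S →* G) : List (S × Bool) → (S → E) →L[𝕜] E
  | [] => 0
  | x :: L => letterDeriv 𝕜 E q x +
      (adModel 𝕜 E (q (FreeGroup.mk [x]))).comp (wordDeriv q L)

variable [LieGroup 𝓘(𝕜, E) ∞ G]

theorem adModel_mul (g h : G) :
    adModel 𝕜 E (g * h) = (adModel 𝕜 E g).comp (adModel 𝕜 E h) := adMap_mul 𝕜 E g h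

variable {𝕜 E}

theorem wordDeriv_apply (q : FreeGroup S →* G) (L : List (S × Bool)) (c : S → E) :
    wordDeriv 𝕜 E q L c = ∑ j : Fin L.length, eps (L.get j).2 •
      adModel 𝕜 E (q (FreeGroup.mk (L.take j) * FreeGroup.of (L.get j).1 ^ eps' (L.get j).2))
        (c (L.get j).1) := by
  induction L with
  | nil => simp [wordDeriv]
  | cons x L ih =>
    refine Eq.trans ?_ (Fin.sum_univ_succ _).symm
    have h1 : letterDeriv 𝕜 E q x c = eps x.2 • adModel 𝕜 E
        (q (FreeGroup.mk [] * FreeGroup.of x.1 ^ eps' x.2)) (c x.1) := by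
      obtain ⟨s, b⟩ := x
      cases b
      · simp [letterDeriv, eps, eps', ← FreeGroup.one_eq_mk]
      · simp [letterDeriv, eps, eps', ← FreeGroup.one_eq_mk, adModel_one]
    have h2 : ∀ j : Fin L.length, FreeGroup.mk (x :: L.take j)
        = FreeGroup.mk [x] * FreeGroup.mk (L.take j) := fun j => by simp
    simp only [wordDeriv, add_apply, ContinuousLinearMap.comp_apply, ih,
      map_sum, map_zsmul]
    congr 1
    refine Finset.sum_congr rfl fun j _ => ?_
    simp only [Fin.val_succ, List.take_succ_cons, h2]
    rw [mul_assoc, map_mul q (FreeGroup.mk [x]), adModel_mul]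
    rfl

variable [Fintype S]

theorem hasUnitDeriv_letter (q : FreeGroup S →* G) (x : S × Bool) :
    HasUnitDeriv 𝕜 (fun c : S → E => perturb 𝕜 E q c (FreeGroup.mk [x]) *
      (q (FreeGroup.mk [x]))⁻¹) (letterDeriv 𝕜 E q x) := by
  obtain ⟨s, b⟩ := x
  have hp := HasUnitDeriv.param G (ContinuousLinearMap.proj (R := 𝕜) (φ := fun _ : S => E) s)
  have hof : FreeGroup.mk [(s, true)] = FreeGroup.of s := rfl
  have hof' : FreeGroup.mk [(s, false)] = (FreeGroup.of s)⁻¹ := rfl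
  cases b
  · refine ((hp.inv.conj (q (FreeGroup.of s))⁻¹).congr_fun fun c => ?_).congr_deriv ?_
    · simp [hof', perturb, mul_assoc]
    · simp [letterDeriv]
  · refine (hp.congr_fun fun c => ?_).congr_deriv ?_
    · simp [hof, perturb]
    · simp [letterDeriv]

theorem hasUnitDeriv_word (q : FreeGroup S →* G) (L : List (S × Bool)) :
    HasUnitDeriv 𝕜 (fun c : S → E => perturb 𝕜 E q c (FreeGroup.mk L) *
      (q (FreeGroup.mk L))⁻¹) (wordDeriv 𝕜 E q L) := by
  induction L with
  | nil => exact HasUnitDeriv.one.congr_fun fun c => by simp [← FreeGroup.one_eq_mk]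
  | cons x L ih =>
    refine ((hasUnitDeriv_letter q x).mul (ih.conj (q (FreeGroup.mk [x])))).congr_fun fun c => ?_
    have h : FreeGroup.mk (x :: L) = FreeGroup.mk [x] * FreeGroup.mk L := by
      simp
    simp only [h, map_mul]
    group

/-! ### The derivative of the conjugation action -/

variable (𝕜 E) in
/-- The coboundary `v ↦ (s ↦ v - Ad(q s) v)`, the negative of the derivative of the orbit map of
`q` under conjugation. -/
def coboundary (q : FreeGroup S →* G) : E →L[𝕜] (S → E) :=
  ContinuousLinearMap.pi fun s => ContinuousLinearMap.id 𝕜 E - adModel 𝕜 E (q (FreeGroup.of s))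

/-- Conjugation of `perturb q c` by `unitParam (-v)` replaces `c` by `c - coboundary q v` up to
first order. -/
theorem hasUnitDeriv_conj_perturb (q : FreeGroup S →* G) (s : S) :
    HasUnitDeriv 𝕜 (fun p : E × (S → E) => unitParam 𝕜 E G (-p.1) *
        perturb 𝕜 E q p.2 (FreeGroup.of s) * (unitParam 𝕜 E G (-p.1))⁻¹ * (q (FreeGroup.of s))⁻¹)
      ((ContinuousLinearMap.proj s).comp
        (ContinuousLinearMap.snd 𝕜 E (S → E) -
          (coboundary 𝕜 E q).comp (ContinuousLinearMap.fst 𝕜 E (S → E)))) := by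
  have h1 := HasUnitDeriv.param G (-ContinuousLinearMap.fst 𝕜 E (S → E))
  have h2 := HasUnitDeriv.param G ((ContinuousLinearMap.proj (R := 𝕜) (φ := fun _ : S => E) s).comp
    (ContinuousLinearMap.snd 𝕜 E (S → E)))
  refine (((h1.mul h2).mul (h1.inv.conj (q (FreeGroup.of s)))).congr_fun
    fun p => ?_).congr_deriv ?_
  · simp [perturb, mul_assoc]
  · ext p <;> simp [coboundary]
    abel

/-- One step of the Newton iteration: a small perturbation of `q` that satisfies sufficiently many
relations of `q` is conjugate to a perturbation of half the size, by an element of controlled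
size. -/
theorem exists_conj_perturb_norm_le_half {T : Type*} (q : FreeGroup S →* G) (w : T → FreeGroup S)
    (hw : ∀ t, q (w t) = 1) (W : T → List (S × Bool)) (hW : ∀ t, FreeGroup.mk (W t) = w t)
    (T₀ : Finset T) {C : ℝ} (hC : 0 < C)
    (hlin : ∀ (δ : ℝ), 0 < δ → ∀ c : S → E, (∀ t ∈ T₀, ‖wordDeriv 𝕜 E q (W t) c‖ < δ) →
      ∃ v, ‖v‖ ≤ C * (‖c‖ + δ) ∧ ‖c - coboundary 𝕜 E q v‖ ≤ C * δ) :
    ∃ ρ > 0, ∀ c : S → E, ‖c‖ < ρ → (∀ t, perturb 𝕜 E q c (w t) = 1) →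
      ∃ (v : E) (c' : S → E), ‖v‖ ≤ 3 * C * ‖c‖ ∧ ‖c'‖ ≤ ‖c‖ / 2 ∧
        ∀ s, perturb 𝕜 E q c' (FreeGroup.of s) = unitParam 𝕜 E G (-v) *
          perturb 𝕜 E q c (FreeGroup.of s) * (unitParam 𝕜 E G (-v))⁻¹ := by
  -- The errors below add up to `(5 * C + 1) * η * ‖c‖`.
  obtain ⟨η, hη, hη1, hηC⟩ : ∃ η : ℝ, 0 < η ∧ η ≤ 1 ∧ (5 * C + 1) * η ≤ 1 / 2 := by
    refine ⟨1 / (2 * (5 * C + 1)), by positivity, ?_, le_of_eq (by field_simp)⟩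
    rw [div_le_one (by positivity)]
    linarith
  have e1 : ∀ᶠ p in 𝓝 (0 : E × (S → E)), ∀ s, _ ∧ _ := Filter.eventually_all.2 fun s =>
    ((hasUnitDeriv_conj_perturb (𝕜 := 𝕜) (E := E) q s).eventually_norm_sub_le hη).and
      (hasUnitDeriv_conj_perturb (𝕜 := 𝕜) (E := E) q s).eventually_unitParam
  have e2 : ∀ᶠ c in 𝓝 (0 : S → E), ∀ t ∈ T₀, _ := (Filter.eventually_all_finset T₀).2 fun t _ =>
    (hasUnitDeriv_word (𝕜 := 𝕜) (E := E) q (W t)).eventually_norm_sub_le hη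
  obtain ⟨ρ₁, hρ₁, h1⟩ := Metric.eventually_nhds_iff.1 e1
  obtain ⟨ρ₂, hρ₂, h2⟩ := Metric.eventually_nhds_iff.1 e2
  refine ⟨min ρ₂ (ρ₁ / (3 * C + 1)), by positivity, fun c hc hcw => ?_⟩
  have hc2 : ‖c‖ < ρ₂ := hc.trans_le (min_le_left _ _)
  have hc1 : ‖c‖ * (3 * C + 1) < ρ₁ :=
    (lt_div_iff₀ (by positivity)).1 (hc.trans_le (min_le_right _ _))
  rcases eq_or_ne c 0 with rfl | hc0
  · exact ⟨0, 0, by simp, by simp, fun s => by simp [unitParam_zero]⟩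
  have hcpos : 0 < ‖c‖ := norm_pos_iff.2 hc0
  obtain ⟨v, hv, hcv⟩ := hlin (2 * η * ‖c‖) (by positivity) c fun t ht => by
    have := h2 (y := c) (by simpa using hc2) t ht
    rw [hW, hcw, hw, inv_one, mul_one, unitChart_one, zero_sub, norm_neg] at this
    nlinarith [mul_pos hη hcpos]
  have hv3 : ‖v‖ ≤ 3 * C * ‖c‖ := by
    refine hv.trans ?_
    have := mul_le_mul_of_nonneg_right hη1 hcpos.le
    nlinarith
  have hp : ‖(v, c)‖ ≤ ‖c‖ * (3 * C + 1) := by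
    rw [Prod.norm_def]
    refine max_le ?_ ?_ <;> nlinarith [mul_pos hC hcpos]
  have hp1 := h1 (y := (v, c)) (by rw [dist_zero_right]; exact hp.trans_lt hc1)
  refine ⟨v, fun s => unitChart 𝕜 E (unitParam 𝕜 E G (-v) * perturb 𝕜 E q c (FreeGroup.of s) *
    (unitParam 𝕜 E G (-v))⁻¹ * (q (FreeGroup.of s))⁻¹), hv3, ?_, fun s => ?_⟩
  · refine (pi_norm_le_iff_of_nonneg (by positivity)).2 fun s => ?_
    have hs := (hp1 s).1
    have hs' : ‖(c - coboundary 𝕜 E q v) s‖ ≤ C * (2 * η * ‖c‖) := (norm_le_pi_norm _ s).trans hcv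
    have := norm_le_norm_sub_add (unitChart 𝕜 E (unitParam 𝕜 E G (-v) *
      perturb 𝕜 E q c (FreeGroup.of s) *
      (unitParam 𝕜 E G (-v))⁻¹ * (q (FreeGroup.of s))⁻¹)) ((c - coboundary 𝕜 E q v) s)
    have hb : η * ‖(v, c)‖ ≤ η * (‖c‖ * (3 * C + 1)) := by gcongr
    have hsum := mul_le_mul_of_nonneg_right hηC hcpos.le
    have hs2 : ‖unitChart 𝕜 E (unitParam 𝕜 E G (-v) * perturb 𝕜 E q c (FreeGroup.of s) *
      (unitParam 𝕜 E G (-v))⁻¹ * (q (FreeGroup.of s))⁻¹) - (c - coboundary 𝕜 E q v) s‖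
        ≤ η * ‖(v, c)‖ := hs
    linarith
  · have hs := (hp1 s).2
    simp only at hs
    rw [perturb, FreeGroup.lift_apply_of, hs, inv_mul_cancel_right]

/-! ### Convergence of the Newton iteration -/

/-- Left multiplication by an element near `1` moves the points near `1` by a distance that is
bounded linearly, in the chart. -/
theorem exists_mul_param : ∃ ρ > 0, ∃ K > 0, ∀ v x : E, ‖v‖ < ρ → ‖x‖ < ρ →
    ∃ y : E, unitParam 𝕜 E G y = unitParam 𝕜 E G v * unitParam 𝕜 E G x ∧ ‖y - x‖ ≤ K * ‖v‖ := by
  have hm := HasUnitDeriv.param_mul_param (𝕜 := 𝕜) (E := E) (G := G)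
  obtain ⟨K, s, hs, hK⟩ := hm.hasStrictFDerivAt.exists_lipschitzOnWith
  obtain ⟨ρ₁, hρ₁, h1⟩ := Metric.eventually_nhds_iff.1
    ((Filter.eventually_mem_set.2 hs).and hm.eventually_unitParam)
  obtain ⟨ρ₂, hρ₂, h2⟩ := Metric.eventually_nhds_iff.1
    (eventually_unitChart_unitParam (G := G) 𝕜 E)
  refine ⟨min ρ₁ ρ₂, by positivity, K + 1, by positivity, fun v x hv hx => ?_⟩
  have hv1 := hv.trans_le (min_le_left _ _)
  have hx1 := hx.trans_le (min_le_left _ _)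
  have hvx := h1 (y := (v, x)) (by rw [dist_zero_right, Prod.norm_def]; exact max_lt hv1 hx1)
  have h0x := h1 (y := (0, x)) (by
    rw [dist_zero_right, Prod.norm_def]; exact max_lt (by simpa using hρ₁) hx1)
  refine ⟨_, hvx.2, ?_⟩
  have h := hK.dist_le_mul _ hvx.1 _ h0x.1
  simp only [unitParam_zero, one_mul,
    h2 (y := x) (by simpa using hx.trans_le (min_le_right _ _))] at h
  rw [dist_eq_norm, dist_eq_norm] at h
  refine h.trans ?_
  have : ‖((v, x) : E × E) - (0, x)‖ = ‖v‖ := by simp [Prod.norm_def]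
  rw [this]
  nlinarith [norm_nonneg v]

end Words

/-- A sequence of steps, each of which halves the error `c` and moves the approximate solution `x`
by at most a multiple of the error, converges. -/
theorem exists_tendsto_of_halving {X Y : Type*} [NormedAddCommGroup X] [CompleteSpace X]
    [NormedAddCommGroup Y] (P : X → Y → Prop) {ρ K : ℝ} (hK : 0 ≤ K)
    (step : ∀ x c, P x c → ‖x‖ < ρ → ‖c‖ < ρ →
      ∃ x' c', P x' c' ∧ ‖c'‖ ≤ ‖c‖ / 2 ∧ ‖x' - x‖ ≤ K * ‖c‖)
    {c₀ : Y} (h0 : P 0 c₀) (hc : ‖c₀‖ < ρ) (hKc : 2 * K * ‖c₀‖ < ρ) :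
    ∃ (x : ℕ → X) (c : ℕ → Y) (l : X), (∀ n, P (x n) (c n)) ∧
      Filter.Tendsto c Filter.atTop (𝓝 0) ∧ Filter.Tendsto x Filter.atTop (𝓝 l) ∧ ‖l‖ < ρ := by
  choose! fx fc hP hfc hfx using step
  let z : ℕ → X × Y := fun n => Nat.rec (0, c₀) (fun _ z => (fx z.1 z.2, fc z.1 z.2)) n
  have hz : ∀ n, P (z n).1 (z n).2 ∧ ‖(z n).2‖ ≤ ‖c₀‖ / 2 ^ n ∧
      ‖(z n).1‖ ≤ 2 * K * ‖c₀‖ * (1 - 1 / 2 ^ n) := by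
    intro n
    induction n with
    | zero => exact ⟨h0, by simp [z], by simp [z]⟩
    | succ n ih =>
      obtain ⟨i1, i2, i3⟩ := ih
      have hpow : (1 : ℝ) ≤ 2 ^ n := one_le_pow₀ (by norm_num)
      have hx : ‖(z n).1‖ < ρ := by
        refine (i3.trans (mul_le_of_le_one_right (by positivity) ?_)).trans_lt hKc
        linarith [show (0 : ℝ) ≤ 1 / 2 ^ n by positivity]
      have hcn : ‖(z n).2‖ < ρ := (i2.trans (div_le_self (norm_nonneg _) hpow)).trans_lt hc
      refine ⟨hP _ _ i1 hx hcn, ?_, ?_⟩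
      · refine (hfc _ _ i1 hx hcn).trans ?_
        rw [pow_succ, ← div_div]
        gcongr
      · have h1 := hfx _ _ i1 hx hcn
        have h2 := norm_le_norm_sub_add (fx (z n).1 (z n).2) (z n).1
        have h3 : K * ‖(z n).2‖ ≤ K * (‖c₀‖ / 2 ^ n) := by gcongr
        calc ‖(z (n + 1)).1‖ ≤ K * (‖c₀‖ / 2 ^ n) + 2 * K * ‖c₀‖ * (1 - 1 / 2 ^ n) := by
              change ‖fx (z n).1 (z n).2‖ ≤ _
              linarith
          _ = _ := by rw [pow_succ]; field_simp; ring
  have hlt : ∀ n, ‖(z n).1‖ < ρ ∧ ‖(z n).2‖ < ρ := by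
    intro n
    obtain ⟨-, i2, i3⟩ := hz n
    have hpow : (1 : ℝ) ≤ 2 ^ n := one_le_pow₀ (by norm_num)
    refine ⟨(i3.trans (mul_le_of_le_one_right (by positivity) ?_)).trans_lt hKc,
      (i2.trans (div_le_self (norm_nonneg _) hpow)).trans_lt hc⟩
    linarith [show (0 : ℝ) ≤ 1 / 2 ^ n by positivity]
  have hdist : ∀ n, dist (z n).1 (z (n + 1)).1 ≤ (2 * K * ‖c₀‖) / 2 / 2 ^ n := by
    intro n
    rw [dist_comm, dist_eq_norm]
    calc _ ≤ K * ‖(z n).2‖ := hfx _ _ (hz n).1 (hlt n).1 (hlt n).2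
      _ ≤ K * (‖c₀‖ / 2 ^ n) := by gcongr; exact (hz n).2.1
      _ = _ := by ring
  obtain ⟨l, hl⟩ := cauchySeq_tendsto_of_complete (cauchySeq_of_le_geometric_two hdist)
  refine ⟨fun n => (z n).1, fun n => (z n).2, l, fun n => (hz n).1, ?_, hl, ?_⟩
  · refine squeeze_zero_norm (fun n => (hz n).2.1) ?_
    have := (tendsto_pow_atTop_nhds_zero_of_lt_one (r := (1 / 2 : ℝ)) (by norm_num)
      (by norm_num)).const_mul ‖c₀‖
    simpa [div_eq_mul_inv] using this
  · have := dist_le_of_le_geometric_two_of_tendsto₀ hdist hl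
    rw [show (z 0).1 = 0 from rfl, dist_zero_left] at this
    exact this.trans_lt hKc

end BanachLie
end

noncomputable section

namespace BanachLie

variable {𝕜 : Type*} [RCLike 𝕜] {E : Type*} [NormedAddCommGroup E] [NormedSpace 𝕜 E]
  {G : Type*} [TopologicalSpace G] [ChartedSpace E G] [Group G] [LieGroup 𝓘(𝕜, E) ∞ G]
  {S T : Type*}

/-- If the linearized equations are almost exact, every sufficiently small perturbation of `q` that
satisfies the relations of `q` is conjugate to `q`. -/
theorem exists_conj_of_perturb [Fintype S] [CompleteSpace E] (q : FreeGroup S →* G)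
    (w : T → FreeGroup S)
    (hw : ∀ t, q (w t) = 1) (W : T → List (S × Bool)) (hW : ∀ t, FreeGroup.mk (W t) = w t)
    (T₀ : Finset T) {C : ℝ} (hC : 0 < C)
    (hlin : ∀ (δ : ℝ), 0 < δ → ∀ c : S → E, (∀ t ∈ T₀, ‖wordDeriv 𝕜 E q (W t) c‖ < δ) →
      ∃ v, ‖v‖ ≤ C * (‖c‖ + δ) ∧ ‖c - coboundary 𝕜 E q v‖ ≤ C * δ) :
    ∃ ρ > 0, ∀ c : S → E, ‖c‖ < ρ → (∀ t, perturb 𝕜 E q c (w t) = 1) →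
      ∃ g : G, perturb 𝕜 E q c = (MulAut.conj g).toMonoidHom.comp q := by
  have : IsTopologicalGroup G := topologicalGroup_of_lieGroup 𝓘(𝕜, E) ∞
  have : T1Space G := ChartedSpace.t1Space E G
  obtain ⟨ρ₁, hρ₁, h1⟩ := exists_conj_perturb_norm_le_half q w hw W hW T₀ hC hlin
  obtain ⟨ρ₂, hρ₂, K, hK, h2⟩ := exists_mul_param (𝕜 := 𝕜) (E := E) (G := G)
  obtain ⟨ρ₃, hρ₃, h3⟩ := Metric.eventually_nhds_iff.1
    (eventually_continuousAt_unitParam (G := G) 𝕜 E)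
  let ρ := min (min ρ₁ (ρ₂ / (3 * C))) (min ρ₂ ρ₃)
  have hρ : 0 < ρ := by positivity
  let K' := K * (3 * C)
  have hK' : 0 < K' := by positivity
  refine ⟨min ρ (ρ / (2 * K')), by positivity, fun c₀ hc₀ hcw => ?_⟩
  -- `x` is a coordinate of the conjugating element, `c` the remaining distance from `q`.
  let P : E → (S → E) → Prop := fun x c =>
    perturb 𝕜 E q c = (MulAut.conj (unitParam 𝕜 E G x)).toMonoidHom.comp (perturb 𝕜 E q c₀)
  have hP0 : P 0 c₀ := by
    ext s
    simp [unitParam_zero]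
  obtain ⟨x, c, l, hP, hc, hx, hl⟩ := exists_tendsto_of_halving P (ρ := ρ) hK'.le (by
    intro x c hP hx hc
    have hcρ₁ : ‖c‖ < ρ₁ := hc.trans_le ((min_le_left _ _).trans (min_le_left _ _))
    have hcρ₂ : ‖c‖ < ρ₂ / (3 * C) := hc.trans_le ((min_le_left _ _).trans (min_le_right _ _))
    obtain ⟨v, c', hv, hc', hcc'⟩ := h1 c hcρ₁ fun t => by
      rw [show perturb 𝕜 E q c = _ from hP]
      simp [hcw]
    have hvρ : ‖-v‖ < ρ₂ := by
      rw [norm_neg]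
      refine hv.trans_lt ?_
      rw [mul_comm]
      exact (lt_div_iff₀ (by positivity)).1 hcρ₂
    obtain ⟨y, hy, hyx⟩ := h2 (-v) x hvρ
      (hx.trans_le ((min_le_right _ _).trans (min_le_left _ _)))
    refine ⟨y, c', ?_, hc', ?_⟩
    · refine FreeGroup.ext_hom _ _ fun s => ?_
      rw [hcc' s, show perturb 𝕜 E q c = _ from hP]
      simp [hy, mul_assoc]
    · rw [norm_neg] at hyx
      refine hyx.trans ?_
      rw [mul_assoc]
      gcongr) hP0 (hc₀.trans_le (min_le_left _ _))
    (by
      have := (lt_div_iff₀ (by positivity)).1 (hc₀.trans_le (min_le_right ρ (ρ / (2 * K'))))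
      linarith)
  have hcont : ContinuousAt (unitParam 𝕜 E G) l :=
    h3 (by simpa using hl.trans_le ((min_le_right _ _).trans (min_le_right _ _)))
  have hgl := hcont.tendsto.comp hx
  refine ⟨(unitParam 𝕜 E G l)⁻¹, FreeGroup.ext_hom _ _ fun s => ?_⟩
  have t1 : Filter.Tendsto (fun n => perturb 𝕜 E q (c n) (FreeGroup.of s)) Filter.atTop
      (𝓝 (q (FreeGroup.of s))) := by
    have hs : Filter.Tendsto (fun n => c n s) Filter.atTop (𝓝 0) := (tendsto_pi_nhds.1 hc) s
    have := ((contMDiffAt_unitParam (G := G) 𝕜 E).continuousAt.tendsto.comp hs).mul_const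
      (q (FreeGroup.of s))
    simpa [unitParam_zero, perturb, Function.comp_def] using this
  have t2 := (hgl.mul_const (perturb 𝕜 E q c₀ (FreeGroup.of s))).mul hgl.inv
  have hlim := tendsto_nhds_unique t1 (t2.congr fun n => by
    rw [show perturb 𝕜 E q (c n) = _ from hP n]
    simp)
  simp [hlim, mul_assoc]

/-! ### Local rigidity from a presentation -/

theorem Presentation.countable [Finite S] {Γ : Type*} [Group Γ] (P : Presentation Γ S T) :
    Countable T := by
  have : Countable (FreeGroup S) :=
    Function.Surjective.countable (f := fun L : List (S × Bool) => FreeGroup.mk L)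
      Quot.mk_surjective
  exact P.basis.injective.countable

theorem Presentation.mk_word {Γ : Type*} [Group Γ] (P : Presentation Γ S T) (t : T) :
    FreeGroup.mk (P.word t) = P.basis t := by
  classical exact FreeGroup.mk_toWord

end BanachLie
end

theorem theorem5p2 {𝕜 : Type*} [RCLike 𝕜]
    {E : Type*} [NormedAddCommGroup E] [NormedSpace 𝕜 E] [CompleteSpace E]
    {G : Type*} [TopologicalSpace G] [ChartedSpace E G] [Group G] [LieGroup 𝓘(𝕜, E) ∞ G]
    {Γ : Type*} [Group Γ] [Group.FG Γ] (r : Γ →* G)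
    {S T : Type*} [Finite S] (P : BanachLie.Presentation Γ S T)
    (hH1 : Subsingleton (BanachLie.H1 P (BanachLie.adRep 𝕜 E r)))
    (hclosed : IsClosed (Set.range (BanachLie.delta1 P (BanachLie.adRep 𝕜 E r)))) :
    BanachLie.LocallyRigid r := by
  open BanachLie in
  have := Fintype.ofFinite S
  have := P.countable
  have : IsTopologicalGroup G := topologicalGroup_of_lieGroup 𝓘(𝕜, E) ∞
  let q : FreeGroup S →* G := r.comp P.π
  let d : (S → E) →L[𝕜] (T → E) := ContinuousLinearMap.pi fun t => wordDeriv 𝕜 E q (P.word t)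
  have hd1 : ∀ c : S → E, d c = delta1 P (adRep 𝕜 E r) c := fun c =>
    funext fun t => wordDeriv_apply q (P.word t) c
  have hd : IsClosed (Set.range d) := by
    have : Set.range d = Set.range (delta1 P (adRep 𝕜 E r)) := congrArg Set.range (funext hd1)
    rw [this]
    exact hclosed
  have hexact : ∀ c : S → E, d c = 0 → ∃ v, coboundary 𝕜 E q v = c := by
    intro c hc
    -- The vanishing of `H¹` says that `ker δ¹ ⊆ im δ⁰`.
    have hle := Submodule.submoduleOf_eq_top.1 (Submodule.Quotient.subsingleton_iff.1 hH1)
    have hmem : c ∈ LinearMap.ker (delta1 P (adRep 𝕜 E r)) := (hd1 c).symm.trans hc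
    obtain ⟨v, hv⟩ := hle hmem
    exact ⟨v, hv⟩
  have hπ : ∀ t, P.π (P.basis t) = 1 := fun t => (P.basis t).2
  obtain ⟨T₀, C, hC, hlin⟩ := exists_finset_almost_exact (coboundary 𝕜 E q) d hd hexact
  obtain ⟨ρ, hρ, hconj⟩ := exists_conj_of_perturb q (fun t => (P.basis t : FreeGroup S))
    (fun t => by simp [q, hπ]) P.word P.mk_word T₀ hC hlin
  obtain ⟨N, hNo, hN1, hN⟩ := exists_nhds_eq_perturb (𝕜 := 𝕜) (E := E) q hρ
  refine ⟨{r' | ∀ s, r' (P.π (FreeGroup.of s)) * (q (FreeGroup.of s))⁻¹ ∈ N}, ?_, ?_, ?_⟩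
  · refine isOpen_induced_iff.2 ⟨{f : Γ → G | ∀ s, f (P.π (FreeGroup.of s)) *
      (q (FreeGroup.of s))⁻¹ ∈ N}, ?_, rfl⟩
    simp only [Set.ofPred_forall]
    refine isOpen_iInter_of_finite fun s => hNo.preimage ?_
    fun_prop
  · intro s
    simpa [q] using hN1
  · intro r' hr'
    obtain ⟨c, hc, hcq⟩ := hN (r'.comp P.π) hr'
    obtain ⟨g, hg⟩ := hconj c hc fun t => by
      rw [← hcq]
      simp [hπ]
    refine ⟨g, fun γ => ?_⟩
    obtain ⟨x, rfl⟩ := P.surjective γ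
    simpa [q] using DFunLike.congr_fun (hcq.trans hg) x
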